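/- \textbf{Setting.} Let $n\ge 2$ (arms) and $k\ge 1$ (contexts). An instance consists of a context probability matrix $A\in\mathbb{R}^{k\times n}$ with strictly positive entries and columns summing to $1$, and of a mean matrix $\mu\in\mathbb{R}^{k\times n}$. In each round $t=1,2,\dots$ the learner pulls an arm $i_t\in[n]$ and then observes a context $z_t\in[k]$ and a reward $y_t\in\mathbb{R}$ with $$\Pr(z_t=j\mid i_t=i)=A_{j,i},\qquad y_t\mid (i_t=i,\,z_t=j)\sim\mathcal N(\mu_{j,i},1),$$ conditionally on the past (non-separator context: the reward may depend on both arm and context). The matrix $A$ is known to the learner and $\mu$ is not. With $A_i,\mu_i$ the $i$-th columns, the expected reward of arm $i$ is $A_i^\top\mu_i$. Let $\mathcal I(A)$ be the set of $\mu$ for which the maximiser $i^*(\mu)=\operatorname{argmax}_i A_i^\top\mu_i$ is unique, and for $\mu\in\mathcal I(A)$ let $\mathrm{Alt}(\mu,A)=\{\mu'\in\mathcal I(A): i^*(\mu')\ne i^*(\mu)\}$. A sampling rule is any, possibly randomized, rule that chooses $i_{t+1}$ based on the history of the first $t$ rounds (and on $A$ and $\delta$). \textbf{GLR stopping rule.}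 Let $N_{j,i}(t)$ be the number of the first $t$ rounds in which arm $i$ was pulled and context $j$ was observed, and $\hat\mu_{j,i}(t)$ the average of the rewards of these rounds. Once $N_{j,i}(t)\ge 1$ for all $i,j$, set $$\hat\Lambda(t)=\inf_{\mu'\in\mathrm{Alt}(\hat\mu(t),A)}\ \sum_{i\in[n],\,j\in[k]}N_{j,i}(t)\,\frac{(\hat\mu_{j,i}(t)-\mu'_{j,i})^2}{2}$$ if $\hat\mu(t)\in\mathcal I(A)$, and $\hat\Lambda(t)=0$ otherwise. For $\delta\in(0,1)$ let $$\hat c_t(\delta)=4k\ln\!\Big(4+\ln\frac{t}{2k}\Big)+2k\,C^g\!\Big(\frac{1}{2k}\ln\frac{n-1}{\delta}\Big),\qquad C^g(x)=\min_{\lambda\in(1/2,1]}\frac{g(\lambda)+x}{\lambda},$$ $$g(\lambda)=2\lambda-2\lambda\ln(4\lambda)+\ln\zeta(2\lambda)-\tfrac12\ln(1-\lambda),$$ where $\zeta$ is the Riemann zeta function and $g(1)=+\infty$. The stopping time is $$\tau_\delta=\inf\{t\in\mathbb N:\ N_{j,i}(t)\ge1 \text{ for all } i,j,\ \text{ and }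 \hat\Lambda(t)>\hat c_t(\delta)\}\in\mathbb N\cup\{\infty\},$$ and the arm recommended at $\tau_\delta<\infty$ is $\hat i_\tau=i^*(\hat\mu(\tau_\delta))$. \textbf{Lemma.} For every $\delta\in(0,1)$ and every sampling rule, the algorithm that uses this sampling rule together with the GLR stopping rule and recommendation above is $\delta$-correct: for every context probability matrix $A$ with positive entries and every $\mu\in\mathcal I(A)$, $$\mathbb P_{\mu,A}\big(\tau_\delta<\infty,\ \hat i_\tau\ne i^*(\mu)\big)\le\delta .$$ -/

import Mathlib

open MeasureTheory ProbabilityTheory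
open scoped ENNReal

namespace PostActionBAI

/-- A known context probability matrix with strictly positive entries:
`prob j i` is the probability of context `j` after pulling arm `i`. -/
structure ContextMatrix (k n : ℕ) where
  prob : Matrix (Fin k) (Fin n) ℝ
  pos : ∀ j i, 0 < prob j i
  sum_eq_one : ∀ i, ∑ j, prob j i = 1

/-- What is recorded in one round: the arm pulled, the post-action context, the reward. -/
abbrev Obs (n k : ℕ) : Type := Fin n × Fin k × ℝ

/-- The history of the first `t` rounds. -/
abbrev History (n k t : ℕ) : Type := Fin t → Obs n k

/-! ### Best arms -/

/-- Expected reward of arm `i`, i.e. the inner product of the `i`-th columns of `A` and `μ`. -/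
noncomputable def armMean {k n : ℕ} (A : ContextMatrix k n) (μ : Matrix (Fin k) (Fin n) ℝ)
    (i : Fin n) : ℝ :=
  ∑ j, A.prob j i * μ j i

/-- Arm `i` is the unique best arm of the instance `(μ, A)`. -/
def IsUniqueBestArm {k n : ℕ} (A : ContextMatrix k n) (μ : Matrix (Fin k) (Fin n) ℝ)
    (i : Fin n) : Prop :=
  ∀ i', i' ≠ i → armMean A μ i' < armMean A μ i

/-- The set of mean matrices that have a unique best arm. -/
def uniqueBestSet {k n : ℕ} (A : ContextMatrix k n) : Set (Matrix (Fin k) (Fin n) ℝ) :=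
  {μ | ∃ i, IsUniqueBestArm A μ i}

/-- The alternative set of `μ`: mean matrices with a unique best arm,
which is not the best arm of `μ`. -/
def altSet {k n : ℕ} (A : ContextMatrix k n) (μ : Matrix (Fin k) (Fin n) ℝ) :
    Set (Matrix (Fin k) (Fin n) ℝ) :=
  {μ' | ∃ i', IsUniqueBestArm A μ' i' ∧ ¬ IsUniqueBestArm A μ i'}

/-! ### The environment and the interaction -/

/-- Joint law of context and reward after pulling arm `i`: the context is `j` with probability
`A j i`, and given it the reward is Gaussian with mean `μ j i` and variance `1`. -/
noncomputable def armLaw {k n : ℕ} (A : ContextMatrix k n) (μ : Matrix (Fin k) (Fin n) ℝ)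
    (i : Fin n) : Measure (Fin k × ℝ) :=
  ∑ j, ENNReal.ofReal (A.prob j i) • (Measure.dirac j).prod (gaussianReal (μ j i) 1)

instance {k n : ℕ} (A : ContextMatrix k n) (μ : Matrix (Fin k) (Fin n) ℝ) (i : Fin n) :
    IsProbabilityMeasure (armLaw A μ i) where
  measure_univ := by
    simp only [armLaw, Measure.coe_finsetSum, Finset.sum_apply, Measure.smul_apply,
      measure_univ, smul_eq_mul, mul_one]
    rw [← ENNReal.ofReal_sum_of_nonneg (fun j _ => (A.pos j i).le), A.sum_eq_one i,
      ENNReal.ofReal_one]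

/-- The environment as a Markov kernel from arms to pairs (context, reward). -/
noncomputable def envKernel {k n : ℕ} (A : ContextMatrix k n) (μ : Matrix (Fin k) (Fin n) ℝ) :
    Kernel (Fin n) (Fin k × ℝ) :=
  Kernel.ofFunOfCountable (armLaw A μ)

instance {k n : ℕ} (A : ContextMatrix k n) (μ : Matrix (Fin k) (Fin n) ℝ) :
    IsMarkovKernel (envKernel A μ) :=
  ⟨fun i => inferInstanceAs (IsProbabilityMeasure (armLaw A μ i))⟩

/-- A (possibly randomized) sampling rule: after `t` rounds, the next arm is drawn from a
distribution that depends measurably on the history of these rounds. -/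
structure SamplingRule (n k : ℕ) where
  next : (t : ℕ) → Kernel (History n k t) (Fin n)
  markov : ∀ t, IsMarkovKernel (next t)

instance {n k : ℕ} (π : SamplingRule n k) (t : ℕ) : IsMarkovKernel (π.next t) := π.markov t

/-- One round of interaction: draw an arm from the sampling rule,
then a context and a reward from the environment. -/
noncomputable def roundKernel {n k : ℕ} (π : SamplingRule n k) (A : ContextMatrix k n)
    (μ : Matrix (Fin k) (Fin n) ℝ) (t : ℕ) : Kernel (History n k t) (Obs n k) :=
  (π.next t).compProd (Kernel.prodMkLeft (History n k t) (envKernel A μ))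

instance {n k : ℕ} (π : SamplingRule n k) (A : ContextMatrix k n)
    (μ : Matrix (Fin k) (Fin n) ℝ) (t : ℕ) : IsMarkovKernel (roundKernel π A μ t) := by
  unfold roundKernel; infer_instance

/-- Reindexing of the coordinates `0, …, t` as a history of `t + 1` rounds. -/
def toHistory {n k : ℕ} (t : ℕ) (x : (s : Finset.Iic t) → Obs n k) : History n k (t + 1) :=
  fun s => x ⟨s, Finset.mem_Iic.2 (Nat.lt_succ_iff.1 s.2)⟩

theorem measurable_toHistory {n k : ℕ} (t : ℕ) : Measurable (toHistory (n := n) (k := k) t) :=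
  measurable_pi_lambda _ fun _ => measurable_pi_apply _

/-- The law of the infinite sequence of rounds when the arms are chosen by `π` in the
instance `(μ, A)` (coordinate `s` is round `s + 1`). -/
noncomputable def law {n k : ℕ} (π : SamplingRule n k) (A : ContextMatrix k n)
    (μ : Matrix (Fin k) (Fin n) ℝ) : Measure (ℕ → Obs n k) :=
  Kernel.trajMeasure (X := fun _ => Obs n k) (roundKernel π A μ 0 Fin.elim0)
    (fun t => (roundKernel π A μ (t + 1)).comap (toHistory t) (measurable_toHistory t))

/-! ### Algorithms and δ-correctness -/

/-- A fixed-confidence algorithm: a sampling rule, a stopping rule and a recommendation rule,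
all based on the history. -/
structure Algorithm (n k : ℕ) where
  sampling : SamplingRule n k
  stopsAt : (t : ℕ) → History n k t → Prop
  recommend : (t : ℕ) → History n k t → Fin n

/-- The first `t` rounds of a trajectory. -/
def firstRounds {n k : ℕ} (ω : ℕ → Obs n k) (t : ℕ) : History n k t := fun s => ω s

/-- The stopping time: the first `t` at which the stopping rule holds, `⊤` if there is none. -/
noncomputable def Algorithm.stopTime {n k : ℕ} (alg : Algorithm n k) (ω : ℕ → Obs n k) : ℕ∞ :=
  sInf {T : ℕ∞ | ∃ t : ℕ, T = t ∧ alg.stopsAt t (firstRounds ω t)}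

/-- An algorithm, which may depend on the known context matrix, is `δ`-correct if in every
instance with a unique best arm the probability to stop and to recommend another arm is
at most `δ`. -/
def IsDeltaCorrect {n k : ℕ} (δ : ℝ) (alg : ContextMatrix k n → Algorithm n k) : Prop :=
  ∀ (A : ContextMatrix k n) (μ : Matrix (Fin k) (Fin n) ℝ) (iStar : Fin n),
    IsUniqueBestArm A μ iStar →
      law (alg A).sampling A μ
        {ω | ∃ t : ℕ, (alg A).stopTime ω = t ∧ (alg A).recommend t (firstRounds ω t) ≠ iStar}
          ≤ ENNReal.ofReal δ

/-! ### The GLR stopping rule -/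

/-- Number of rounds in which arm `i` was pulled and context `j` was observed. -/
def pairCount {n k t : ℕ} (h : History n k t) (j : Fin k) (i : Fin n) : ℕ :=
  (Finset.univ.filter fun s => (h s).1 = i ∧ (h s).2.1 = j).card

/-- Empirical mean rewards (meaningful for pairs that were observed at least once). -/
noncomputable def empMean {n k t : ℕ} (h : History n k t) : Matrix (Fin k) (Fin n) ℝ :=
  fun j i => (∑ s with (h s).1 = i ∧ (h s).2.1 = j, (h s).2.2) / pairCount h j i

open Classical in
/-- The generalized likelihood ratio statistic;
it is zero if the empirical means have no unique best arm. -/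
noncomputable def glr {n k t : ℕ} (A : ContextMatrix k n) (h : History n k t) : ℝ :=
  if empMean h ∈ uniqueBestSet A then
    sInf ((fun μ' : Matrix (Fin k) (Fin n) ℝ =>
      ∑ i, ∑ j, (pairCount h j i : ℝ) * ((empMean h j i - μ' j i) ^ 2 / 2)) ''
        altSet A (empMean h))
  else 0

/-- `g(x) = 2x - 2x ln(4x) + ln ζ(2x) - ln(1 - x) / 2` for `1/2 < x < 1`. -/
noncomputable def gFun (x : ℝ) : ℝ :=
  2 * x - 2 * x * Real.log (4 * x) + Real.log (riemannZeta ((2 * x : ℝ) : ℂ)).re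
    - 1 / 2 * Real.log (1 - x)

/-- `C^g(x)`, the minimum of `(g(l) + x) / l` over `1/2 < l ≤ 1`. The endpoint `l = 1`, at which
`g` is `+∞`, is left out because `Real.log 0 = 0`. -/
noncomputable def cG (x : ℝ) : ℝ :=
  sInf ((fun l : ℝ => (gFun l + x) / l) '' Set.Ioo (1 / 2) 1)

/-- The threshold `ĉ_t(δ)`. -/
noncomputable def threshold (n k : ℕ) (δ : ℝ) (t : ℕ) : ℝ :=
  4 * k * Real.log (4 + Real.log (t / (2 * k)))
    + 2 * k * cG (Real.log ((n - 1) / δ) / (2 * k))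

/-- The GLR stopping rule. It is applied once every pair of an arm and a context has been
observed, so that the empirical means are defined. -/
def glrStop {n k t : ℕ} (δ : ℝ) (A : ContextMatrix k n) (h : History n k t) : Prop :=
  (∀ j i, 0 < pairCount h j i) ∧ threshold n k δ t < glr A h

/-- The algorithm stops by the GLR rule and then recommends the empirical best arm;
its sampling rule is arbitrary. -/
structure UsesGLRStopping {n k : ℕ} (δ : ℝ) (A : ContextMatrix k n) (alg : Algorithm n k) :
    Prop where
  stop_iff : ∀ (t : ℕ) (h : History n k t), alg.stopsAt t h ↔ glrStop δ A h
  recommend_eq : ∀ (t : ℕ) (h : History n k t) (i : Fin n), glrStop δ A h →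
    IsUniqueBestArm A (empMean h) i → alg.recommend t h = i

end PostActionBAI

open scoped NNReal

namespace PostActionBAI

/-! ### Gaussian mixtures -/

/-! On the error event the empirical best arm `b` is worse than `iStar` under `μ`. Keeping the
empirical means except on these two arms, where `μ` is used, and raising a maximiser infinitesimally
gives an alternative, so the GLR statistic is at most the cost of the `2k` pairs of `b` and `iStar`
(`glr_le_of_lt`). Only these deviations need time-uniform control, hence the dimension `2k` in the
threshold; the union bound over the `n - 1` choices of `b` accounts for `ln ((n - 1) / δ)`.

For a fixed shift `θ` the Gaussian likelihood ratio is a martingale of mean one under every sampling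
rule. Averaging over a product prior on `θ` preserves this, and Ville's inequality
(`measure_exists_le_of_supermartingale`) bounds the probability that the average ever reaches `e^x`.
The prior of each relevant pair mixes centred Gaussians with variances on a geometric grid; the
slice adapted to the count `N` yields the exponential of `l` times the penalized deviation minus
`g(l)` (`exp_le_lintegral_mixturePrior`). Jensen's inequality collects the penalties `2 ln (4 + ln
N)` into the first term of the threshold, and optimising over `l` gives `C^g`. -/

theorem hasSum_zeta_re {s : ℝ} (hs : 1 < s) :
    HasSum (fun m : ℕ => ((m : ℝ) + 1) ^ (-s)) (riemannZeta (s : ℂ)).re := by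
  have hsum : Summable (fun m : ℕ => ((m : ℝ) + 1) ^ (-s)) := by
    have := (summable_nat_add_iff 1).2 (Real.summable_nat_rpow.2 (neg_lt_neg hs))
    simpa using this
  have hz : riemannZeta (s : ℂ) = ((∑' m : ℕ, ((m : ℝ) + 1) ^ (-s) : ℝ) : ℂ) := by
    rw [zeta_eq_tsum_one_div_nat_add_one_cpow (by simpa using hs), Complex.ofReal_tsum]
    refine tsum_congr fun m => ?_
    rw [Complex.ofReal_cpow (by positivity)]
    push_cast
    rw [Complex.cpow_neg, one_div]
  rw [hz, Complex.ofReal_re]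
  exact hsum.hasSum

theorem one_le_zeta_re {s : ℝ} (hs : 1 < s) : 1 ≤ (riemannZeta (s : ℂ)).re := by
  have h := (hasSum_zeta_re hs).tsum_eq
  rw [← h]
  have := (hasSum_zeta_re hs).summable.le_tsum 0 (fun m _ => by positivity)
  simpa using this

/-- The exponential martingale integrated against a centred Gaussian prior of variance `v`. -/
theorem lintegral_exp_gaussianReal {v : ℝ≥0} (hv : v ≠ 0) (N S : ℝ) (hN : 0 ≤ N) :
    ∫⁻ θ, ENNReal.ofReal (Real.exp (θ * S - θ ^ 2 / 2 * N)) ∂gaussianReal 0 v =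
      ENNReal.ofReal ((√(1 + N * v))⁻¹ * Real.exp (S ^ 2 * v / (2 * (1 + N * v)))) := by
  have hv0 : (0 : ℝ) < v := by positivity
  have hD : (0 : ℝ) < 1 + N * v := by positivity
  -- Completing the square, prior density times likelihood is a constant times the posterior
  -- density, Gaussian with mean `w * S` and variance `w`.
  set w : ℝ≥0 := v / (1 + ⟨N, hN⟩ * v) with hw
  have hwr : (w : ℝ) = v / (1 + N * v) := by rw [hw]; push_cast; rfl
  have hw0 : w ≠ 0 := by
    have : (0 : ℝ) < w := by rw [hwr]; positivity
    exact fun h => by simp [h] at this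
  rw [gaussianReal_of_var_ne_zero _ hv, lintegral_withDensity_eq_lintegral_mul _
    (measurable_gaussianPDF 0 v) (by fun_prop)]
  have key : ∀ θ : ℝ, (gaussianPDF 0 v * fun θ => ENNReal.ofReal
      (Real.exp (θ * S - θ ^ 2 / 2 * N))) θ =
      ENNReal.ofReal ((√(1 + N * v))⁻¹ * Real.exp (S ^ 2 * v / (2 * (1 + N * v)))) *
        gaussianPDF (w * S) w θ := by
    intro θ
    simp only [Pi.mul_apply, gaussianPDF]
    rw [← ENNReal.ofReal_mul (gaussianPDFReal_nonneg _ _ _), ← ENNReal.ofReal_mul (by positivity)]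
    congr 1
    simp only [gaussianPDFReal, hwr]
    have h1 : √(2 * Real.pi * (v / (1 + N * v))) = √(2 * Real.pi * v) / √(1 + N * v) := by
      rw [← Real.sqrt_div' _ hD.le]; congr 1; ring
    rw [h1, inv_div]
    have hs : √(1 + N * v) ≠ 0 := (Real.sqrt_pos.2 hD).ne'
    have e : Real.exp (-(θ - 0) ^ 2 / (2 * v)) * Real.exp (θ * S - θ ^ 2 / 2 * N) =
        Real.exp (S ^ 2 * v / (2 * (1 + N * v))) *
          Real.exp (-(θ - v / (1 + N * v) * S) ^ 2 / (2 * (v / (1 + N * v)))) := by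
      rw [← Real.exp_add, ← Real.exp_add]
      congr 1
      field_simp
      ring
    calc _ = (√(2 * Real.pi * v))⁻¹ * (Real.exp (-(θ - 0) ^ 2 / (2 * v)) *
          Real.exp (θ * S - θ ^ 2 / 2 * N)) := by ring
      _ = _ := by rw [e]; field_simp
  simp_rw [key]
  rw [lintegral_const_mul _ (measurable_gaussianPDF _ _), lintegral_gaussianPDF_eq_one _ hw0,
    mul_one]

/-- Weights of the slices of the prior. -/
noncomputable def priorWeight (l : ℝ) (m : ℕ) : ℝ :=
  ((m : ℝ) + 1) ^ (-(2 * l)) / (riemannZeta ((2 * l : ℝ) : ℂ)).re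

/-- Variances of the slices of the prior. -/
noncomputable def priorVar (l : ℝ) (m : ℕ) : ℝ≥0 :=
  Real.toNNReal (l / (1 - l) * Real.exp (-(4 * l * m)))

/-- A mixture of centred Gaussian laws, with variances on a geometric grid. -/
noncomputable def mixturePrior (l : ℝ) : Measure ℝ :=
  Measure.sum fun m => ENNReal.ofReal (priorWeight l m) • gaussianReal 0 (priorVar l m)

theorem isProbabilityMeasure_mixturePrior {l : ℝ} (hl : 1 / 2 < l) :
    IsProbabilityMeasure (mixturePrior l) := by
  have hs : (1 : ℝ) < 2 * l := by linarith
  have hz : 0 < (riemannZeta ((2 * l : ℝ) : ℂ)).re := one_pos.trans_le (one_le_zeta_re hs)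
  constructor
  rw [mixturePrior, Measure.sum_apply _ MeasurableSet.univ]
  simp only [Measure.smul_apply, measure_univ, smul_eq_mul, mul_one]
  have h := (hasSum_zeta_re hs).div_const (riemannZeta ((2 * l : ℝ) : ℂ)).re
  rw [div_self hz.ne'] at h
  unfold priorWeight
  rw [← ENNReal.ofReal_tsum_of_nonneg (fun m => by positivity) h.summable,
    h.tsum_eq, ENNReal.ofReal_one]

theorem slice_le_lintegral_mixturePrior (l : ℝ) (f : ℝ → ℝ≥0∞) (m : ℕ) :
    ENNReal.ofReal (priorWeight l m) * ∫⁻ θ, f θ ∂gaussianReal 0 (priorVar l m) ≤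
      ∫⁻ θ, f θ ∂mixturePrior l := by
  rw [mixturePrior, lintegral_sum_measure]
  refine le_trans (le_of_eq ?_) (ENNReal.le_tsum m)
  rw [lintegral_smul_measure, smul_eq_mul]

/-- The mixture martingale dominates the exponential of the self-normalized deviation. -/
theorem exp_le_lintegral_mixturePrior {l : ℝ} (hl : 1 / 2 < l) (hl1 : l < 1) {N : ℝ} (hN : 1 ≤ N)
    (S : ℝ) :
    ENNReal.ofReal (Real.exp (l * (S ^ 2 / (2 * N) - 2 * Real.log (4 + Real.log N)) - gFun l)) ≤
      ∫⁻ θ, ENNReal.ofReal (Real.exp (θ * S - θ ^ 2 / 2 * N)) ∂mixturePrior l := by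
  have hs : (1 : ℝ) < 2 * l := by linarith
  set Z := (riemannZeta ((2 * l : ℝ) : ℂ)).re with hZ
  have hz : 0 < Z := one_pos.trans_le (one_le_zeta_re hs)
  have hN0 : 0 < N := by linarith
  have hlogN : 0 ≤ Real.log N := Real.log_nonneg hN
  have hc : 0 < 4 * l := by linarith
  have h1l : 0 < 1 - l := by linarith
  -- The slice with `exp (-(4 * l * m))` within a factor `exp (4 * l)` of `1 / N`.
  set m := ⌊Real.log N / (4 * l)⌋₊ with hm
  have hm1 : 4 * l * m ≤ Real.log N := by
    have := Nat.floor_le (div_nonneg hlogN hc.le)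
    rw [← hm, le_div_iff₀ hc] at this
    linarith
  have hm2 : Real.log N ≤ 4 * l * m + 4 * l := by
    have := Nat.lt_floor_add_one (Real.log N / (4 * l))
    rw [← hm, div_lt_iff₀ hc] at this
    linarith
  have hv0 : 0 < l / (1 - l) * Real.exp (-(4 * l * m)) := by positivity
  have hv : (priorVar l m : ℝ) = l / (1 - l) * Real.exp (-(4 * l * m)) :=
    Real.coe_toNNReal _ hv0.le
  have hvne : priorVar l m ≠ 0 := by simpa [priorVar] using hv0
  refine le_trans ?_ (slice_le_lintegral_mixturePrior l _ m)
  rw [lintegral_exp_gaussianReal hvne N S hN0.le]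
  set v : ℝ := (priorVar l m : ℝ) with hvdef
  rw [← hv] at hv0
  have hw0 : 0 < priorWeight l m := by unfold priorWeight; positivity
  rw [← ENNReal.ofReal_mul hw0.le]
  apply ENNReal.ofReal_le_ofReal
  have hNexp : Real.exp (Real.log N) = N := Real.exp_log hN0
  have hNv : N * v = l / (1 - l) * Real.exp (Real.log N - 4 * l * m) := by
    rw [hv, Real.exp_sub, Real.exp_neg, hNexp]; ring
  -- The factor `l / (1 - l)` in the variance is chosen so that `N v / (1 + N v) ≥ l`, which gives
  -- the slope `l` in the exponent.
  have hNv1 : l / (1 - l) ≤ N * v := by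
    rw [hNv]
    exact le_mul_of_one_le_right (by positivity) (Real.one_le_exp (by linarith))
  have hNv2 : 1 + N * v ≤ Real.exp (4 * l) / (1 - l) := by
    have h1 : N * v ≤ l / (1 - l) * Real.exp (4 * l) := by
      rw [hNv]
      gcongr
      linarith
    have h2 : 1 ≤ Real.exp (4 * l) := Real.one_le_exp hc.le
    have h3 : Real.exp (4 * l) / (1 - l) = Real.exp (4 * l) + l / (1 - l) * Real.exp (4 * l) := by
      field_simp; ring
    linarith
  have hD : 0 < 1 + N * v := by positivity
  have hexpo : l * (S ^ 2 / (2 * N)) ≤ S ^ 2 * v / (2 * (1 + N * v)) := by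
    have h4 : l * (1 + N * v) ≤ N * v := by
      rw [div_le_iff₀ h1l] at hNv1
      linarith
    rw [mul_div_assoc', div_le_div_iff₀ (by positivity) (by positivity)]
    nlinarith [mul_le_mul_of_nonneg_left h4 (sq_nonneg S)]
  have hsq : Real.log ((√(1 + N * v))⁻¹) = -(Real.log (1 + N * v) / 2) := by
    rw [Real.log_inv, Real.log_sqrt hD.le]
  have hlogD : Real.log (1 + N * v) ≤ 4 * l - Real.log (1 - l) := by
    have := Real.log_le_log hD hNv2
    rwa [Real.log_div (Real.exp_pos _).ne' h1l.ne', Real.log_exp] at this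
  have hlogw : Real.log (priorWeight l m) = -(2 * l) * Real.log (m + 1) - Real.log Z := by
    rw [priorWeight, Real.log_div (by positivity) hz.ne', Real.log_rpow (by positivity)]
  -- The price of selecting slice `m`; `l < 1` replaces `4 * l + log N` by `4 + log N`.
  have hlogm : Real.log (m + 1) ≤ Real.log (4 + Real.log N) - Real.log (4 * l) := by
    rw [← Real.log_div (by positivity) hc.ne']
    apply Real.log_le_log (by positivity)
    rw [le_div_iff₀ hc]
    linarith
  have hpos : 0 < (√(1 + N * v))⁻¹ := inv_pos.2 (Real.sqrt_pos.2 hD)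
  rw [← Real.exp_log hw0, ← Real.exp_log hpos, ← Real.exp_add, ← Real.exp_add]
  apply Real.exp_le_exp.2
  rw [hsq, hlogw]
  unfold gFun
  rw [← hZ]
  nlinarith [mul_le_mul_of_nonneg_left hlogm (by linarith : 0 ≤ 2 * l)]

/-! ### The threshold -/

/-- The terms `log ζ`, `-log (1 - l) / 2` and `x` are nonnegative and can be dropped, and `4 * l ≤
4`. -/
theorem le_gFun_add_div {l x : ℝ} (hl : 1 / 2 < l) (hl1 : l < 1) (hx : 0 ≤ x) :
    2 - 2 * Real.log 4 ≤ (gFun l + x) / l := by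
  have hs : (1 : ℝ) < 2 * l := by linarith
  have h1 := Real.log_nonneg (one_le_zeta_re hs)
  have h2 : Real.log (1 - l) ≤ 0 := Real.log_nonpos (by linarith) (by linarith)
  have h3 : Real.log (4 * l) ≤ Real.log 4 := Real.log_le_log (by linarith) (by linarith)
  rw [le_div_iff₀ (by linarith)]
  unfold gFun
  nlinarith [mul_le_mul_of_nonneg_left h3 (by linarith : 0 ≤ 2 * l)]

theorem le_cG {x : ℝ} (hx : 0 ≤ x) : 2 - 2 * Real.log 4 ≤ cG x := by
  refine le_csInf ((Set.nonempty_Ioo.2 (by norm_num)).image _) ?_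
  rintro _ ⟨l, hl, rfl⟩
  exact le_gFun_add_div hl.1 hl.2 hx

/-- Near-minimisers suffice later, so attainment of the infimum is never needed. -/
theorem exists_gFun_add_div_lt {x y : ℝ} (hy : cG x < y) :
    ∃ l, 1 / 2 < l ∧ l < 1 ∧ (gFun l + x) / l < y := by
  obtain ⟨_, ⟨l, hl, rfl⟩, h⟩ :=
    exists_lt_of_csInf_lt ((Set.nonempty_Ioo.2 (by norm_num)).image _) hy
  exact ⟨l, hl.1, hl.2, h⟩

theorem threshold_nonneg {n k t : ℕ} {δ : ℝ} (hk : 0 < k) (hx : 0 ≤ Real.log ((n - 1) / δ))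
    (ht : 2 * k ≤ t) : 0 ≤ threshold n k δ t := by
  have hk0 : (0 : ℝ) < k := by exact_mod_cast hk
  have h1 := le_cG (x := Real.log ((n - 1) / δ) / (2 * k)) (by positivity)
  have ht' : (2 * k : ℝ) ≤ t := by exact_mod_cast ht
  have h2 : 0 ≤ Real.log (t / (2 * k)) :=
    Real.log_nonneg (by rw [le_div_iff₀ (by positivity)]; linarith)
  have h3 : Real.log 4 ≤ Real.log (4 + Real.log (t / (2 * k))) :=
    Real.log_le_log (by norm_num) (by linarith)
  unfold threshold
  -- The two `log 4` contributions cancel and leave the lower bound `4k`.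
  have h4 := mul_le_mul_of_nonneg_left h3 (by positivity : (0 : ℝ) ≤ 4 * k)
  have h5 := mul_le_mul_of_nonneg_left h1 (by positivity : (0 : ℝ) ≤ 2 * k)
  nlinarith

/-- Jensen's inequality for the iterated logarithm. -/
theorem sum_log_four_add_log_le {ι : Type*} (s : Finset ι) (hs : s.Nonempty) (N : ι → ℝ)
    (hN : ∀ a ∈ s, 1 ≤ N a) {t : ℝ} (ht : ∑ a ∈ s, N a ≤ t) :
    ∑ a ∈ s, Real.log (4 + Real.log (N a)) ≤
      s.card * Real.log (4 + Real.log (t / s.card)) := by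
  have hc : (0 : ℝ) < s.card := by exact_mod_cast hs.card_pos
  have hw : ∑ _a ∈ s, (1 / (s.card : ℝ)) = 1 := by
    rw [Finset.sum_const, nsmul_eq_mul]; field_simp
  have jensen : ∀ f : ι → ℝ, (∀ a ∈ s, 0 < f a) →
      ∑ a ∈ s, Real.log (f a) ≤ s.card * Real.log ((∑ a ∈ s, f a) / s.card) := by
    intro f hf
    have := strictConcaveOn_log_Ioi.concaveOn.le_map_sum (t := s) (w := fun _ => 1 / (s.card : ℝ))
      (p := f) (fun _ _ => by positivity) hw hf
    simp only [smul_eq_mul, ← Finset.mul_sum] at this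
    rw [one_div_mul_eq_div, one_div_mul_eq_div, div_le_iff₀ hc] at this
    linarith
  have hlog : ∀ a ∈ s, 0 ≤ Real.log (N a) := fun a ha => Real.log_nonneg (hN a ha)
  have hsum : 0 < ∑ a ∈ s, N a := Finset.sum_pos (fun a ha => one_pos.trans_le (hN a ha)) hs
  -- Concavity of the logarithm is used twice: here for `4 + log N`, then for `N` itself inside the
  -- outer logarithm.
  refine (jensen _ fun a ha => by linarith [hlog a ha]).trans ?_
  have h1 := jensen N fun a ha => one_pos.trans_le (hN a ha)
  have h2 : Real.log ((∑ a ∈ s, N a) / s.card) ≤ Real.log (t / s.card) :=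
    Real.log_le_log (by positivity) (by gcongr)
  have h3 : 0 ≤ ∑ a ∈ s, Real.log (N a) := Finset.sum_nonneg hlog
  have h4 : (∑ a ∈ s, (4 + Real.log (N a))) / s.card = 4 + (∑ a ∈ s, Real.log (N a)) / s.card := by
    rw [Finset.sum_add_distrib, Finset.sum_const, nsmul_eq_mul]; field_simp
  rw [h4]
  apply mul_le_mul_of_nonneg_left _ hc.le
  apply Real.log_le_log (by positivity)
  have : (∑ a ∈ s, Real.log (N a)) / s.card ≤ Real.log (t / s.card) := by
    rw [div_le_iff₀ hc]
    nlinarith [mul_le_mul_of_nonneg_left h2 hc.le]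
  linarith

theorem lintegral_pi_prod {ι : Type*} [Fintype ι] (ν : ι → Measure ℝ)
    [∀ p, IsProbabilityMeasure (ν p)] (X : ι → ℝ → ℝ≥0∞) (hX : ∀ p, Measurable (X p)) :
    ∫⁻ θ, ∏ p, X p (θ p) ∂Measure.pi ν = ∏ p, ∫⁻ x, X p x ∂ν p := by
  have h := lintegral_prod_eq_prod_lintegral_of_indepFun Finset.univ
    (fun p (θ : ι → ℝ) => X p (θ p)) (iIndepFun_pi (μ := ν) fun p => (hX p).aemeasurable)
    (fun p => (hX p).comp (measurable_pi_apply p))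
  refine h.trans (Finset.prod_congr rfl fun p _ => ?_)
  exact (measurePreserving_eval ν p).lintegral_comp (hX p)

/-! ### A maximal inequality for nonnegative supermartingales along the interaction -/

section Interaction

variable {n k : ℕ} (π : SamplingRule n k) (A : ContextMatrix k n) (μ : Matrix (Fin k) (Fin n) ℝ)

instance : IsProbabilityMeasure (law π A μ) := by
  unfold law; infer_instance

theorem firstRounds_succ (ω : ℕ → Obs n k) (t : ℕ) :
    firstRounds ω (t + 1) = Fin.snoc (α := fun _ => Obs n k) (firstRounds ω t) (ω t) := by
  funext s
  refine Fin.lastCases ?_ (fun r => ?_) s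
  · simp [firstRounds]
  · simp [firstRounds]

theorem measurable_firstRounds (t : ℕ) :
    Measurable fun ω : ℕ → Obs n k => firstRounds ω t :=
  measurable_pi_lambda _ fun _ => measurable_pi_apply _

theorem measurable_snoc (t : ℕ) :
    Measurable fun p : History n k t × Obs n k =>
      (Fin.snoc (α := fun _ => Obs n k) p.1 p.2 : History n k (t + 1)) := by
  refine measurable_pi_lambda _ fun s => ?_
  refine Fin.lastCases ?_ (fun r => ?_) s
  · simp only [Fin.snoc_last]
    exact measurable_snd
  · simp only [Fin.snoc_castSucc]
    exact (measurable_pi_apply r).comp measurable_fst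

theorem map_eval_zero_law :
    (law π A μ).map (fun ω => ω 0) = roundKernel π A μ 0 Fin.elim0 := by
  have h : (law π A μ).map (Preorder.frestrictLe (π := fun _ => Obs n k) 0) =
      (roundKernel π A μ 0 Fin.elim0).map
        (MeasurableEquiv.piUnique (fun _ : Finset.Iic 0 => Obs n k)).symm := by
    rw [law, Kernel.trajMeasure, Measure.map_comp _ _ (by fun_prop), Kernel.traj_map_frestrictLe,
      Kernel.partialTraj_self, Measure.id_comp]
  have h2 : (fun ω : ℕ → Obs n k => ω 0) =
      (fun x : (s : Finset.Iic 0) → Obs n k => x default) ∘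
        Preorder.frestrictLe (π := fun _ => Obs n k) 0 := by
    funext ω; rfl
  rw [h2, ← Measure.map_map (by fun_prop) (by fun_prop), h, Measure.map_map (by fun_prop)
    (by fun_prop)]
  exact Measure.map_id

/-- Given the first `t` rounds, the next one is distributed according to the round kernel. -/
theorem lintegral_law_next (t : ℕ) (F : History n k t × Obs n k → ℝ≥0∞) (hF : Measurable F) :
    ∫⁻ ω, F (firstRounds ω t, ω t) ∂law π A μ =
      ∫⁻ ω, ∫⁻ o, F (firstRounds ω t, o) ∂roundKernel π A μ t (firstRounds ω t) ∂law π A μ := by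
  -- The first round is the initial measure of `trajMeasure`, whose kernels only produce the later
  -- rounds; hence the split and the index shift.
  cases t with
  | zero =>
    have h0 : ∀ ω : ℕ → Obs n k, firstRounds ω 0 = Fin.elim0 := fun ω => Subsingleton.elim _ _
    simp only [h0, lintegral_const, measure_univ, mul_one]
    rw [← map_eval_zero_law π A μ, lintegral_map (by fun_prop) (by fun_prop)]
  | succ t =>
    have h := Kernel.map_frestrictLe_trajMeasure_compProd_eq_map_trajMeasure
      (X := fun _ => Obs n k) (μ₀ := roundKernel π A μ 0 Fin.elim0)
      (κ := fun t => (roundKernel π A μ (t + 1)).comap (toHistory t) (measurable_toHistory t))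
      (a := t)
    have hG : Measurable fun p : ((s : Finset.Iic t) → Obs n k) × Obs n k =>
        F (toHistory t p.1, p.2) :=
      hF.comp (((measurable_toHistory t).comp measurable_fst).prodMk measurable_snd)
    have h2 := congrArg (fun m => ∫⁻ p, F (toHistory t p.1, p.2) ∂m) h
    rw [lintegral_map hG (by fun_prop), Measure.lintegral_compProd hG,
      lintegral_map (Measurable.lintegral_kernel_prod_right' hG) (by fun_prop)] at h2
    exact h2.symm

/-- Ville's inequality. Let `E t` be the event of staying below `c` up to time `t`. The quantity `c
* P (E t)ᶜ + ∫ over E t of f t` never exceeds one: mass leaving `E t` has `f ≥ c` at that moment,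
which pays for the growth of the first term. -/
theorem measure_exists_le_of_supermartingale (f : (t : ℕ) → History n k t → ℝ≥0∞)
    (hf : ∀ t, Measurable (f t)) (h0 : ∀ h, f 0 h ≤ 1)
    (hstep : ∀ t h, ∫⁻ o, f (t + 1) (Fin.snoc (α := fun _ => Obs n k) h o) ∂roundKernel π A μ t h ≤
      f t h) (c : ℝ≥0∞) :
    c * law π A μ {ω | ∃ t, c ≤ f t (firstRounds ω t)} ≤ 1 := by
  set P := law π A μ
  -- Formulated on histories, so that its indicator is constant when the next observation is
  -- integrated out.
  let B : (t : ℕ) → Set (History n k t) := fun t =>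
    {h | ∀ s (hs : s ≤ t), f s (fun r => h (Fin.castLE hs r)) < c}
  have hB : ∀ t, MeasurableSet (B t) := by
    intro t
    simp only [B, Set.ofPred_forall]
    refine MeasurableSet.iInter fun s => MeasurableSet.iInter fun hs => ?_
    exact measurableSet_lt ((hf s).comp (measurable_pi_lambda _ fun _ => measurable_pi_apply _))
      measurable_const
  let E : ℕ → Set (ℕ → Obs n k) := fun t => {ω | ∀ s ≤ t, f s (firstRounds ω s) < c}
  have hEB : ∀ t, E t = (fun ω => firstRounds ω t) ⁻¹' B t := fun t => rfl
  have hE : ∀ t, MeasurableSet (E t) := fun t => by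
    rw [hEB]; exact measurable_firstRounds t (hB t)
  have hEanti : ∀ t, E (t + 1) ⊆ E t := fun t ω h s hs => h s (by omega)
  have hmart : ∀ t, ∫⁻ ω in E t, f (t + 1) (firstRounds ω (t + 1)) ∂P ≤
      ∫⁻ ω in E t, f t (firstRounds ω t) ∂P := by
    intro t
    let F : History n k t × Obs n k → ℝ≥0∞ := fun p =>
      (B t).indicator 1 p.1 * f (t + 1) (Fin.snoc (α := fun _ => Obs n k) p.1 p.2)
    have hF : Measurable F :=
      ((measurable_one.indicator (hB t)).comp measurable_fst).mul ((hf _).comp (measurable_snoc t))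
    have h1 := lintegral_law_next π A μ t F hF
    rw [← lintegral_indicator (hE t), ← lintegral_indicator (hE t)]
    have hind : ∀ (ω : ℕ → Obs n k) (y : ℝ≥0∞),
        (B t).indicator 1 (firstRounds ω t) * y = (E t).indicator (fun _ => y) ω := by
      intro ω y
      by_cases h : ω ∈ E t
      · have h' : firstRounds ω t ∈ B t := h
        simp [h, h']
      · have h' : firstRounds ω t ∉ B t := h
        simp [h, h']
    calc _ = ∫⁻ ω, F (firstRounds ω t, ω t) ∂P := by
          refine lintegral_congr fun ω => ?_
          simp only [F, ← firstRounds_succ, hind]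
          rfl
      _ = _ := h1
      _ ≤ _ := by
          refine lintegral_mono fun ω => ?_
          have hp : Measurable fun o : Obs n k => (firstRounds ω t, o) := measurable_prodMk_left
          have hm : Measurable fun o =>
              f (t + 1) (Fin.snoc (α := fun _ => Obs n k) (firstRounds ω t) o) :=
            ((hf (t + 1)).comp (measurable_snoc t)).comp hp
          simp only [F]
          rw [lintegral_const_mul _ hm]
          refine (mul_le_mul_right (hstep t _) _).trans (le_of_eq ?_)
          rw [hind]
          rfl
  have hind : ∀ t, c * P (E t)ᶜ + ∫⁻ ω in E t, f t (firstRounds ω t) ∂P ≤ 1 := by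
    intro t
    induction t with
    | zero =>
      have h1 : c * P (E 0)ᶜ ≤ ∫⁻ ω in (E 0)ᶜ, f 0 (firstRounds ω 0) ∂P := by
        rw [← setLIntegral_const]
        refine setLIntegral_mono' (hE 0).compl fun ω hω => ?_
        by_contra hlt
        refine hω fun s hs => ?_
        obtain rfl : s = 0 := by omega
        exact not_le.1 hlt
      calc _ ≤ ∫⁻ ω in (E 0)ᶜ, f 0 (firstRounds ω 0) ∂P +
            ∫⁻ ω in E 0, f 0 (firstRounds ω 0) ∂P := add_le_add_left h1 _
        _ = ∫⁻ ω, f 0 (firstRounds ω 0) ∂P := by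
            rw [add_comm, lintegral_add_compl _ (hE 0)]
        _ ≤ ∫⁻ _, 1 ∂P := lintegral_mono fun ω => h0 _
        _ = 1 := by simp
    | succ t ih =>
      have hd : MeasurableSet (E t \ E (t + 1)) := (hE t).diff (hE (t + 1))
      have h1 : c * P (E t \ E (t + 1)) ≤
          ∫⁻ ω in E t \ E (t + 1), f (t + 1) (firstRounds ω (t + 1)) ∂P := by
        rw [← setLIntegral_const]
        refine setLIntegral_mono' hd fun ω hω => ?_
        by_contra hlt
        refine hω.2 fun s hs => ?_
        rcases Nat.lt_or_ge t s with h | h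
        · obtain rfl : s = t + 1 := by omega
          exact not_le.1 hlt
        · exact hω.1 s h
      have h2 : (E (t + 1))ᶜ = (E t)ᶜ ∪ (E t \ E (t + 1)) := by
        ext ω
        have := @hEanti t ω
        simp only [Set.mem_compl_iff, Set.mem_union, Set.mem_sdiff]
        tauto
      have h3 : P (E (t + 1))ᶜ ≤ P (E t)ᶜ + P (E t \ E (t + 1)) := by
        rw [h2]; exact measure_union_le _ _
      have h4 : ∫⁻ ω in E t \ E (t + 1), f (t + 1) (firstRounds ω (t + 1)) ∂P +
          ∫⁻ ω in E (t + 1), f (t + 1) (firstRounds ω (t + 1)) ∂P =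
          ∫⁻ ω in E t, f (t + 1) (firstRounds ω (t + 1)) ∂P := by
        rw [← lintegral_union (hE (t + 1)) Set.disjoint_sdiff_left,
          Set.sdiff_union_of_subset (hEanti t)]
      calc _ ≤ c * (P (E t)ᶜ + P (E t \ E (t + 1))) +
            ∫⁻ ω in E (t + 1), f (t + 1) (firstRounds ω (t + 1)) ∂P := by gcongr
        _ = c * P (E t)ᶜ + (c * P (E t \ E (t + 1)) +
            ∫⁻ ω in E (t + 1), f (t + 1) (firstRounds ω (t + 1)) ∂P) := by
            rw [mul_add, add_assoc]
        _ ≤ c * P (E t)ᶜ + ∫⁻ ω in E t, f (t + 1) (firstRounds ω (t + 1)) ∂P := by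
            rw [← h4]; gcongr
        _ ≤ c * P (E t)ᶜ + ∫⁻ ω in E t, f t (firstRounds ω t) ∂P := by
            gcongr 1; exact hmart t
        _ ≤ 1 := ih
  have hU : {ω | ∃ t, c ≤ f t (firstRounds ω t)} ⊆ ⋃ t, (E t)ᶜ := by
    rintro ω ⟨t, ht⟩
    exact Set.mem_iUnion.2 ⟨t, fun h => (h t le_rfl).not_ge ht⟩
  have hmono : Monotone fun t => (E t)ᶜ :=
    monotone_nat_of_le_succ fun t => Set.compl_subset_compl.2 (hEanti t)
  calc _ ≤ c * P (⋃ t, (E t)ᶜ) := by gcongr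
    _ = ⨆ t, c * P (E t)ᶜ := by rw [hmono.measure_iUnion, ENNReal.mul_iSup]
    _ ≤ 1 := iSup_le fun t => le_self_add.trans (hind t)

/-! ### The mixture martingale -/

/-- Likelihood ratio of one observation when the mean of its pair is shifted by `θ`. -/
noncomputable def likelihoodRatio (θ : Fin n × Fin k → ℝ) (o : Obs n k) : ℝ≥0∞ :=
  ENNReal.ofReal (Real.exp (θ (o.1, o.2.1) * (o.2.2 - μ o.2.1 o.1) - θ (o.1, o.2.1) ^ 2 / 2))

theorem measurable_likelihoodRatio :
    Measurable fun p : (Fin n × Fin k → ℝ) × Obs n k => likelihoodRatio μ p.1 p.2 := by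
  have h1 : Measurable fun p : (Fin n × Fin k → ℝ) × (Fin n × Fin k) => p.1 p.2 :=
    measurable_from_prod_countable_left fun q => measurable_pi_apply q
  have h2 : Measurable fun p : (Fin n × Fin k → ℝ) × Obs n k => p.1 (p.2.1, p.2.2.1) :=
    h1.comp (by fun_prop :
      Measurable fun p : (Fin n × Fin k → ℝ) × Obs n k => (p.1, (p.2.1, p.2.2.1)))
  have h3 : Measurable fun p : (Fin n × Fin k → ℝ) × Obs n k => μ p.2.2.1 p.2.1 :=
    (Measurable.of_discrete (f := fun q : Fin n × Fin k => μ q.2 q.1)).comp (by fun_prop :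
      Measurable fun p : (Fin n × Fin k → ℝ) × Obs n k => (p.2.1, p.2.2.1))
  unfold likelihoodRatio
  fun_prop

theorem measurable_likelihoodRatio_left (o : Obs n k) :
    Measurable fun θ => likelihoodRatio μ θ o := by
  unfold likelihoodRatio
  fun_prop

theorem measurable_likelihoodRatio_right (θ : Fin n × Fin k → ℝ) :
    Measurable fun o => likelihoodRatio μ θ o :=
  (measurable_likelihoodRatio μ).comp measurable_prodMk_left

theorem lintegral_exp_gaussianReal_one (m θ : ℝ) :
    ∫⁻ y, ENNReal.ofReal (Real.exp (θ * (y - m) - θ ^ 2 / 2)) ∂gaussianReal m 1 = 1 := by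
  have h : ∀ y : ℝ, Real.exp (θ * (y - m) - θ ^ 2 / 2) =
      Real.exp (-(m * θ + θ ^ 2 / 2)) * Real.exp (θ * y) := by
    intro y; rw [← Real.exp_add]; congr 1; ring
  simp only [h]
  rw [← ofReal_integral_eq_lintegral_ofReal ((integrable_exp_mul_gaussianReal θ).const_mul _)
    (ae_of_all _ fun y => by positivity), integral_const_mul]
  have := congrFun (mgf_id_gaussianReal (μ := m) (v := 1)) θ
  simp only [mgf, id] at this
  rw [this, ← Real.exp_add]
  simp

/-- The Gaussian moment generating function gives mean one for every arm and context, so the law of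
the drawn arm plays no role. -/
theorem lintegral_likelihoodRatio (θ : Fin n × Fin k → ℝ) (t : ℕ) (h : History n k t) :
    ∫⁻ o, likelihoodRatio μ θ o ∂roundKernel π A μ t h = 1 := by
  have hm : Measurable (likelihoodRatio μ θ) := measurable_likelihoodRatio_right μ θ
  rw [roundKernel, Kernel.lintegral_compProd _ _ _ hm]
  have hi : ∀ i, ∫⁻ c, likelihoodRatio μ θ (i, c) ∂(armLaw A μ i) = 1 := by
    intro i
    rw [armLaw, lintegral_finsetSum_measure]
    have hj : ∀ j, ∫⁻ c, likelihoodRatio μ θ (i, c)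
        ∂((Measure.dirac j).prod (gaussianReal (μ j i) 1)) = 1 := by
      intro j
      have hm' : Measurable fun c => likelihoodRatio μ θ (i, c) := hm.comp measurable_prodMk_left
      rw [lintegral_prod _ hm'.aemeasurable, lintegral_dirac]
      exact lintegral_exp_gaussianReal_one (μ j i) (θ (i, j))
    simp only [lintegral_smul_measure, hj, smul_eq_mul, mul_one]
    rw [← ENNReal.ofReal_sum_of_nonneg (fun j _ => (A.pos j i).le), A.sum_eq_one i,
      ENNReal.ofReal_one]
  calc _ = ∫⁻ _, 1 ∂(π.next t h) := lintegral_congr fun i => hi i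
    _ = 1 := by simp

variable (ν : Fin n × Fin k → Measure ℝ) [∀ p, IsProbabilityMeasure (ν p)]

/-- Likelihood ratio of a history, averaged over the shifts. -/
noncomputable def mixtureRatio (t : ℕ) (h : History n k t) : ℝ≥0∞ :=
  ∫⁻ θ, ∏ s, likelihoodRatio μ θ (h s) ∂Measure.pi ν

theorem measurable_prod_likelihoodRatio (t : ℕ) :
    Measurable fun p : (Fin n × Fin k → ℝ) × History n k t =>
      ∏ s, likelihoodRatio μ p.1 (p.2 s) :=
  Finset.measurable_fun_prod _ fun s _ => (measurable_likelihoodRatio μ).comp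
    (measurable_fst.prodMk ((measurable_pi_apply s).comp measurable_snd))

theorem measurable_mixtureRatio (t : ℕ) : Measurable (mixtureRatio μ ν t) :=
  (measurable_prod_likelihoodRatio μ t).lintegral_prod_left'

/-- By Tonelli the next observation is integrated first, for fixed `θ`, where its factor has mean
one. -/
theorem lintegral_mixtureRatio_snoc (t : ℕ) (h : History n k t) :
    ∫⁻ o, mixtureRatio μ ν (t + 1) (Fin.snoc (α := fun _ => Obs n k) h o) ∂roundKernel π A μ t h =
      mixtureRatio μ ν t h := by
  have hsplit : ∀ (o : Obs n k) (θ : Fin n × Fin k → ℝ),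
      ∏ s, likelihoodRatio μ θ ((Fin.snoc (α := fun _ => Obs n k) h o : History n k (t + 1)) s) =
        (∏ s, likelihoodRatio μ θ (h s)) * likelihoodRatio μ θ o := by
    intro o θ
    rw [Fin.prod_univ_castSucc]
    simp only [Fin.snoc_castSucc, Fin.snoc_last]
  have hm1 : Measurable fun θ : Fin n × Fin k → ℝ => ∏ s, likelihoodRatio μ θ (h s) :=
    Finset.measurable_fun_prod _ fun s _ => measurable_likelihoodRatio_left μ (h s)
  have hm2 : Measurable fun p : Obs n k × (Fin n × Fin k → ℝ) => likelihoodRatio μ p.2 p.1 :=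
    (measurable_likelihoodRatio μ).comp measurable_swap
  have hm : Measurable fun p : Obs n k × (Fin n × Fin k → ℝ) =>
      (∏ s, likelihoodRatio μ p.2 (h s)) * likelihoodRatio μ p.2 p.1 :=
    (hm1.comp measurable_snd).mul hm2
  unfold mixtureRatio
  simp only [hsplit]
  rw [lintegral_lintegral_swap hm.aemeasurable]
  refine lintegral_congr fun θ => ?_
  rw [lintegral_const_mul _ (measurable_likelihoodRatio_right μ θ), lintegral_likelihoodRatio, mul_one]

/-- Grouping the rounds by pair shows that counts and empirical means are sufficient statistics;
with a product prior the mixture then factorizes over pairs. -/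
theorem prod_likelihoodRatio {t : ℕ} (h : History n k t) (hpos : ∀ j i, 0 < pairCount h j i)
    (θ : Fin n × Fin k → ℝ) :
    ∏ s, likelihoodRatio μ θ (h s) = ∏ p : Fin n × Fin k, ENNReal.ofReal (Real.exp
      (θ p * (pairCount h p.2 p.1 * (empMean h p.2 p.1 - μ p.2 p.1)) -
        θ p ^ 2 / 2 * pairCount h p.2 p.1)) := by
  unfold likelihoodRatio
  rw [← ENNReal.ofReal_prod_of_nonneg (fun _ _ => (Real.exp_pos _).le),
    ← ENNReal.ofReal_prod_of_nonneg (fun _ _ => (Real.exp_pos _).le), ← Real.exp_sum,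
    ← Real.exp_sum]
  congr 2
  rw [← Finset.sum_fiberwise Finset.univ (fun s => ((h s).1, (h s).2.1))]
  refine Finset.sum_congr rfl fun p _ => ?_
  obtain ⟨i, j⟩ := p
  have hN : (pairCount h j i : ℝ) ≠ 0 := by exact_mod_cast (hpos j i).ne'
  have hfilter : ∀ s, ((h s).1, (h s).2.1) = (i, j) ↔ (h s).1 = i ∧ (h s).2.1 = j := fun s => by
    simp
  simp only [hfilter, empMean]
  rw [Finset.sum_congr rfl (g := fun s => θ (i, j) * ((h s).2.2 - μ j i) - θ (i, j) ^ 2 / 2)]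
  · have hmul : ∀ a b : ℝ, (pairCount h j i : ℝ) * (a / pairCount h j i - b) =
        a - pairCount h j i * b := fun a b => by rw [mul_sub, mul_div_cancel₀ _ hN]
    rw [Finset.sum_sub_distrib, ← Finset.mul_sum, Finset.sum_sub_distrib, Finset.sum_const,
      Finset.sum_const, nsmul_eq_mul, nsmul_eq_mul, ← pairCount, hmul]
    ring
  · intro s hs
    obtain ⟨rfl, rfl⟩ := (Finset.mem_filter.1 hs).2
    rfl

theorem mixtureRatio_eq_prod {t : ℕ} (h : History n k t) (hpos : ∀ j i, 0 < pairCount h j i) :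
    mixtureRatio μ ν t h = ∏ p : Fin n × Fin k, ∫⁻ θ, ENNReal.ofReal (Real.exp
      (θ * (pairCount h p.2 p.1 * (empMean h p.2 p.1 - μ p.2 p.1)) -
        θ ^ 2 / 2 * pairCount h p.2 p.1)) ∂ν p := by
  unfold mixtureRatio
  simp only [prod_likelihoodRatio μ h hpos]
  let X : Fin n × Fin k → ℝ → ℝ≥0∞ := fun p θ => ENNReal.ofReal (Real.exp
      (θ * (pairCount h p.2 p.1 * (empMean h p.2 p.1 - μ p.2 p.1)) -
        θ ^ 2 / 2 * pairCount h p.2 p.1))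
  exact lintegral_pi_prod ν X fun p => by fun_prop

end Interaction

/-! ### Deviation inequality at a fixed slope `l` -/

/-- Self-normalized deviation of the empirical mean of a pair, penalized by an iterated
logarithm. -/
noncomputable def penalizedDeviation {n k t : ℕ} (μ : Matrix (Fin k) (Fin n) ℝ)
    (h : History n k t) (j : Fin k) (i : Fin n) : ℝ :=
  pairCount h j i * ((empMean h j i - μ j i) ^ 2 / 2) -
    2 * Real.log (4 + Real.log (pairCount h j i))

/-- A Dirac prior at zero contributes the factor one, so arms outside `S` cost nothing, while each
pair of an arm in `S` costs one `gFun l`. -/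
theorem exp_sum_le_mixtureRatio {n k t : ℕ} (μ : Matrix (Fin k) (Fin n) ℝ) (h : History n k t)
    (hpos : ∀ j i, 0 < pairCount h j i) (S : Finset (Fin n)) {l : ℝ} (hl : 1 / 2 < l)
    (hl1 : l < 1) (ν : Fin n × Fin k → Measure ℝ) [∀ p, IsProbabilityMeasure (ν p)]
    (hν : ∀ p, p.1 ∈ S → ν p = mixturePrior l) (hν' : ∀ p, p.1 ∉ S → ν p = Measure.dirac 0) :
    ENNReal.ofReal (Real.exp (∑ i ∈ S, ∑ j, (l * penalizedDeviation μ h j i - gFun l))) ≤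
      mixtureRatio μ ν t h := by
  rw [mixtureRatio_eq_prod μ ν h hpos, Fintype.prod_prod_type]
  have hsum : ∑ i ∈ S, ∑ j, (l * penalizedDeviation μ h j i - gFun l) =
      ∑ i, ∑ j, if i ∈ S then l * penalizedDeviation μ h j i - gFun l else 0 := by
    rw [← Finset.sum_subset (Finset.subset_univ S) fun i _ hi => by simp [hi]]
    exact Finset.sum_congr rfl fun i hi => by simp [hi]
  rw [hsum, Real.exp_sum, ENNReal.ofReal_prod_of_nonneg (fun _ _ => (Real.exp_pos _).le)]
  refine Finset.prod_le_prod' fun i _ => ?_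
  rw [Real.exp_sum, ENNReal.ofReal_prod_of_nonneg (fun _ _ => (Real.exp_pos _).le)]
  refine Finset.prod_le_prod' fun j _ => ?_
  have hN : (1 : ℝ) ≤ pairCount h j i := by exact_mod_cast hpos j i
  by_cases hi : i ∈ S
  · rw [if_pos hi, hν _ hi]
    -- With `S = N * (empMean - μ)`, the exponent `S ^ 2 / (2 * N)` is the cost of the pair.
    refine le_trans (le_of_eq ?_) (exp_le_lintegral_mixturePrior hl hl1 hN _)
    congr 3
    unfold penalizedDeviation
    field_simp
  · rw [if_neg hi, hν' _ hi, lintegral_dirac]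
    simp

theorem law_exists_le_sum_penalizedDeviation {n k : ℕ} (π : SamplingRule n k)
    (A : ContextMatrix k n) (μ : Matrix (Fin k) (Fin n) ℝ) (S : Finset (Fin n)) {l : ℝ}
    (hl : 1 / 2 < l) (hl1 : l < 1) (x : ℝ) :
    law π A μ {ω | ∃ t, (∀ j i, 0 < pairCount (firstRounds ω t) j i) ∧
      x ≤ ∑ i ∈ S, ∑ j, (l * penalizedDeviation μ (firstRounds ω t) j i - gFun l)} ≤
      ENNReal.ofReal (Real.exp (-x)) := by
  have := isProbabilityMeasure_mixturePrior hl
  let ν : Fin n × Fin k → Measure ℝ := fun p =>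
    if p.1 ∈ S then mixturePrior l else Measure.dirac 0
  have hprob : ∀ p, IsProbabilityMeasure (ν p) := fun p => by
    simp only [ν]; split_ifs <;> infer_instance
  have h := measure_exists_le_of_supermartingale π A μ (mixtureRatio μ ν)
    (measurable_mixtureRatio μ ν) (fun h => by simp [mixtureRatio])
    (fun t h => (lintegral_mixtureRatio_snoc π A μ ν t h).le) (ENNReal.ofReal (Real.exp x))
  have hx : 0 < Real.exp x := Real.exp_pos x
  rw [Real.exp_neg, ENNReal.ofReal_inv_of_pos hx, ENNReal.le_inv_iff_mul_le, mul_comm]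
  refine le_trans ?_ h
  refine mul_le_mul_right (measure_mono ?_) _
  rintro ω ⟨t, hpos, ht⟩
  exact ⟨t, (ENNReal.ofReal_le_ofReal (Real.exp_le_exp.2 ht)).trans
    (exp_sum_le_mixtureRatio μ _ hpos S hl hl1 ν (fun p hp => if_pos hp) (fun p hp => if_neg hp))⟩

/-! ### The GLR statistic on the error event -/

section Statistic

variable {n k t : ℕ}

theorem sum_pairCount (h : History n k t) : ∑ i, ∑ j, pairCount h j i = t := by
  have h1 := Finset.card_eq_sum_card_fiberwise (s := Finset.univ) (t := Finset.univ)
    (f := fun s => ((h s).1, (h s).2.1)) (fun _ _ => by simp)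
  rw [Finset.card_univ, Fintype.card_fin, Fintype.sum_prod_type] at h1
  refine Eq.trans ?_ h1.symm
  refine Finset.sum_congr rfl fun i _ => Finset.sum_congr rfl fun j _ => ?_
  simp only [pairCount, Prod.mk.injEq]

theorem two_mul_le_of_pairCount_pos (hn : 2 ≤ n) (h : History n k t)
    (hpos : ∀ j i, 0 < pairCount h j i) : 2 * k ≤ t := by
  calc 2 * k ≤ n * k := Nat.mul_le_mul_right k hn
    _ = ∑ _i : Fin n, ∑ _j : Fin k, 1 := by simp
    _ ≤ ∑ i, ∑ j, pairCount h j i :=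
      Finset.sum_le_sum fun i _ => Finset.sum_le_sum fun j _ => hpos j i
    _ = t := sum_pairCount h

theorem glr_le_of_lt (A : ContextMatrix k n) (h : History n k t) {b iStar : Fin n}
    (hb : IsUniqueBestArm A (empMean h) b) (μ : Matrix (Fin k) (Fin n) ℝ)
    (hμ : armMean A μ b < armMean A μ iStar) :
    glr A h ≤ ∑ i ∈ {b, iStar}, ∑ j, (pairCount h j i : ℝ) * ((empMean h j i - μ j i) ^ 2 / 2) := by
  classical
  let S : Finset (Fin n) := {b, iStar}
  let μ₀ : Matrix (Fin k) (Fin n) ℝ := fun j i => if i ∈ S then μ j i else empMean h j i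
  have hS : ∀ i ∈ S, armMean A μ₀ i = armMean A μ i := fun i hi => by simp [armMean, μ₀, hi]
  have : Nonempty (Fin n) := ⟨b⟩
  -- The maximiser may be a third arm or be tied; all that matters is `c ≠ b`.
  obtain ⟨c, hc⟩ := Finite.exists_max (armMean A μ₀)
  have hcb : c ≠ b := by
    rintro rfl
    have h1 := hc iStar
    rw [hS c (by simp [S]), hS iStar (by simp [S])] at h1
    linarith
  -- Columns of `A` sum to one, so this raises the mean of `c` by exactly `ε` and breaks ties;
  -- continuity of the cost then allows `ε → 0`.
  let pert : ℝ → Matrix (Fin k) (Fin n) ℝ := fun ε j i => μ₀ j i + if i = c then ε else 0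
  have hpert : ∀ ε i, armMean A (pert ε) i = armMean A μ₀ i + if i = c then ε else 0 := by
    intro ε i
    simp only [armMean, pert, mul_add, Finset.sum_add_distrib, ← Finset.sum_mul, A.sum_eq_one,
      one_mul]
  let cost : ℝ → ℝ := fun ε => ∑ i, ∑ j, (pairCount h j i : ℝ) *
    ((empMean h j i - pert ε j i) ^ 2 / 2)
  have hle : ∀ ε, 0 < ε → glr A h ≤ cost ε := by
    intro ε hε
    rw [glr, if_pos ⟨b, hb⟩]
    refine csInf_le ⟨0, ?_⟩ ⟨pert ε, ⟨c, fun i hi => ?_, fun hcb' => ?_⟩, rfl⟩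
    · rintro _ ⟨μ', -, rfl⟩
      positivity
    · rw [hpert, hpert, if_neg hi, if_pos rfl]
      linarith [hc i]
    · exact lt_asymm (hb c hcb) (hcb' b hcb.symm)
  have hcont : Continuous cost := by
    refine continuous_finsetSum _ fun i _ => continuous_finsetSum _ fun j _ => ?_
    by_cases hi : i = c
    · simp only [pert, hi, if_true]; fun_prop
    · simp only [pert, hi, if_false]; fun_prop
  have hlim : glr A h ≤ cost 0 :=
    ge_of_tendsto (hcont.continuousWithinAt (s := Set.Ioi 0) (x := 0))
      (eventually_nhdsWithin_of_forall fun ε hε => hle ε hε)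
  refine hlim.trans (le_of_eq ?_)
  simp only [cost]
  rw [← Finset.sum_subset (Finset.subset_univ S)]
  · refine Finset.sum_congr rfl fun i hi => ?_
    have hi' : i ∈ S := hi
    simp [pert, μ₀, hi']
  · intro i _ hi
    simp [pert, μ₀, hi]

/-- When the GLR rule stops and the empirical best arm `b` is worse than `iStar`, the deviations
of these two arms exceed the level that is calibrated for them. -/
theorem lt_sum_penalizedDeviation (A : ContextMatrix k n) (hk : 0 < k) {δ : ℝ}
    (h : History n k t) (hstopped : glrStop δ A h) {b iStar : Fin n}
    (hb : IsUniqueBestArm A (empMean h) b) (μ : Matrix (Fin k) (Fin n) ℝ)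
    (hμ : armMean A μ b < armMean A μ iStar) :
    2 * k * cG (Real.log ((n - 1) / δ) / (2 * k)) <
      ∑ i ∈ {b, iStar}, ∑ j, penalizedDeviation μ h j i := by
  classical
  obtain ⟨hpos, hthr⟩ := hstopped
  have hne : b ≠ iStar := by rintro rfl; exact lt_irrefl _ hμ
  have hglr := glr_le_of_lt A h hb μ hμ
  have : Nonempty (Fin k) := ⟨⟨0, hk⟩⟩
  let S : Finset (Fin n × Fin k) := {b, iStar} ×ˢ Finset.univ
  have hcard : (S.card : ℝ) = 2 * k := by
    rw [Finset.card_product, Finset.card_pair hne, Finset.card_univ, Fintype.card_fin]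
    push_cast; ring
  have hSne : S.Nonempty := by simp [S]
  have ht : ∑ p ∈ S, (pairCount h p.2 p.1 : ℝ) ≤ t := by
    have h1 : ∑ p ∈ S, pairCount h p.2 p.1 ≤ t := by
      refine (Finset.sum_le_sum_of_subset (Finset.subset_univ S)).trans_eq ?_
      rw [Fintype.sum_prod_type, sum_pairCount h]
    exact_mod_cast h1
  -- Twice this bound over `2k` pairs is exactly the first term of the threshold.
  have hj := sum_log_four_add_log_le S hSne (fun p => (pairCount h p.2 p.1 : ℝ))
    (fun p _ => by exact_mod_cast hpos p.2 p.1) ht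
  rw [hcard, Finset.sum_product] at hj
  have hpen : ∑ i ∈ {b, iStar}, ∑ j, penalizedDeviation μ h j i =
      ∑ i ∈ {b, iStar}, ∑ j, (pairCount h j i : ℝ) * ((empMean h j i - μ j i) ^ 2 / 2) -
        2 * ∑ i ∈ {b, iStar}, ∑ j, Real.log (4 + Real.log (pairCount h j i)) := by
    simp only [penalizedDeviation, Finset.sum_sub_distrib, ← Finset.mul_sum]
  rw [hpen]
  unfold threshold at hthr
  linarith

/-- With tied empirical best arms the statistic is zero, which cannot exceed a nonnegative
threshold. -/
theorem exists_isUniqueBestArm_of_glrStop (A : ContextMatrix k n) (hn : 2 ≤ n) (hk : 0 < k) {δ : ℝ}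
    (hx : 0 ≤ Real.log ((n - 1) / δ)) (h : History n k t) (hstopped : glrStop δ A h) :
    ∃ b, IsUniqueBestArm A (empMean h) b := by
  by_contra hno
  have hno' : empMean h ∉ uniqueBestSet A := hno
  have h1 := hstopped.2
  rw [glr, if_neg hno'] at h1
  exact h1.not_ge (threshold_nonneg hk hx (two_mul_le_of_pairCount_pos hn h hstopped.1))

end Statistic

/-! ### Calibration by `cG` and conclusion -/

theorem Algorithm.stopsAt_of_stopTime_eq {n k : ℕ} (alg : Algorithm n k) {ω : ℕ → Obs n k} {t : ℕ}
    (h : alg.stopTime ω = t) : alg.stopsAt t (firstRounds ω t) := by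
  have hne : {T : ℕ∞ | ∃ t : ℕ, T = t ∧ alg.stopsAt t (firstRounds ω t)}.Nonempty := by
    by_contra hempty
    rw [Algorithm.stopTime, Set.not_nonempty_iff_eq_empty.1 hempty, sInf_empty] at h
    exact ENat.top_ne_natCast t h
  obtain ⟨s, hs, hstopped⟩ := csInf_mem hne
  have hst : (s : ℕ∞) = t := by rw [← hs]; exact h
  obtain rfl : s = t := by exact_mod_cast hst
  exact hstopped

/-- Time-uniform deviation inequality for the pairs of a set of arms, calibrated by `cG`. -/
theorem law_exists_lt_sum_penalizedDeviation {n k : ℕ} (π : SamplingRule n k)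
    (A : ContextMatrix k n) (μ : Matrix (Fin k) (Fin n) ℝ) (S : Finset (Fin n))
    (hS : 0 < S.card * k) (x : ℝ) :
    law π A μ {ω | ∃ t, (∀ j i, 0 < pairCount (firstRounds ω t) j i) ∧
      S.card * k * cG (x / (S.card * k)) <
        ∑ i ∈ S, ∑ j, penalizedDeviation μ (firstRounds ω t) j i} ≤
      ENNReal.ofReal (Real.exp (-x)) := by
  have hd : (0 : ℝ) < S.card * k := by exact_mod_cast hS
  set d : ℝ := S.card * k with hdef
  -- The slack `1 / (m + 1)` leaves room for a near-optimal `l`. The bound on `B m` does not depend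
  -- on `m`, and these sets increase to a set covering the strict event.
  let B : ℕ → Set (ℕ → Obs n k) := fun m =>
    {ω | ∃ t, (∀ j i, 0 < pairCount (firstRounds ω t) j i) ∧
      d * (cG (x / d) + 1 / (m + 1)) ≤
        ∑ i ∈ S, ∑ j, penalizedDeviation μ (firstRounds ω t) j i}
  have hmono : Monotone B := by
    rintro m m' hm ω ⟨t, hpos, ht⟩
    refine ⟨t, hpos, le_trans ?_ ht⟩
    gcongr
  have hB : ∀ m, law π A μ (B m) ≤ ENNReal.ofReal (Real.exp (-x)) := by
    intro m
    obtain ⟨l, hl, hl1, hlt⟩ := exists_gFun_add_div_lt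
      (lt_add_of_pos_right (cG (x / d)) (Nat.one_div_pos_of_nat (α := ℝ) (n := m)))
    refine (measure_mono ?_).trans (law_exists_le_sum_penalizedDeviation π A μ S hl hl1 x)
    rintro ω ⟨t, hpos, ht⟩
    refine ⟨t, hpos, ?_⟩
    have hl0 : 0 < l := by linarith
    simp only [Finset.sum_sub_distrib, ← Finset.mul_sum, Finset.sum_const, Finset.card_univ,
      Fintype.card_fin, nsmul_eq_mul]
    rw [div_lt_iff₀ hl0] at hlt
    have h1 := mul_le_mul_of_nonneg_left hlt.le hd.le
    have h2 := mul_le_mul_of_nonneg_left ht hl0.le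
    have h3 : d * (gFun l + x / d) = d * gFun l + x := by field_simp
    rw [← mul_assoc, mul_comm (k : ℝ), ← hdef]
    nlinarith
  have hsub : {ω | ∃ t, (∀ j i, 0 < pairCount (firstRounds ω t) j i) ∧
      d * cG (x / d) < ∑ i ∈ S, ∑ j, penalizedDeviation μ (firstRounds ω t) j i} ⊆ ⋃ m, B m := by
    rintro ω ⟨t, hpos, ht⟩
    rw [mul_comm, ← lt_div_iff₀ hd] at ht
    obtain ⟨m, hm⟩ := exists_nat_one_div_lt (sub_pos.2 ht)
    refine Set.mem_iUnion.2 ⟨m, t, hpos, ?_⟩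
    rw [mul_comm, ← le_div_iff₀ hd]
    linarith
  refine (measure_mono hsub).trans ?_
  rw [hmono.measure_iUnion]
  exact iSup_le hB

end PostActionBAI

theorem mainTheorem5 {n k : ℕ} (hn : 2 ≤ n) (δ : ℝ) (hδ0 : 0 < δ) (hδ1 : δ < 1)
    (alg : PostActionBAI.ContextMatrix k n → PostActionBAI.Algorithm n k)
    (halg : ∀ A, PostActionBAI.UsesGLRStopping δ A (alg A)) :
    PostActionBAI.IsDeltaCorrect δ alg := by
  open PostActionBAI in
  classical
  intro A μ iStar hbest
  -- Without contexts the columns of `A` would sum to zero.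
  have hk : 0 < k := by
    rcases Nat.eq_zero_or_pos k with rfl | hk
    · simpa using A.sum_eq_one iStar
    · exact hk
  have hn1 : (1 : ℝ) ≤ n - 1 := by
    have : (2 : ℝ) ≤ n := by exact_mod_cast hn
    linarith
  set x := Real.log ((n - 1) / δ) with hxdef
  have hx : 0 ≤ x := Real.log_nonneg (by rw [le_div_iff₀ hδ0]; linarith)
  have hexp : Real.exp (-x) = δ / (n - 1) := by
    rw [Real.exp_neg, hxdef, Real.exp_log (by positivity), inv_div]
  let E : Fin n → Set (ℕ → Obs n k) := fun b =>
    {ω | ∃ t, (∀ j i, 0 < pairCount (firstRounds ω t) j i) ∧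
      2 * k * cG (x / (2 * k)) <
        ∑ i ∈ {b, iStar}, ∑ j, penalizedDeviation μ (firstRounds ω t) j i}
  have hE : ∀ b ∈ Finset.univ.erase iStar,
      law (alg A).sampling A μ (E b) ≤ ENNReal.ofReal (δ / (n - 1)) := by
    intro b hb
    have hcard : ({b, iStar} : Finset (Fin n)).card = 2 :=
      Finset.card_pair (Finset.ne_of_mem_erase hb)
    have h := law_exists_lt_sum_penalizedDeviation (alg A).sampling A μ {b, iStar}
      (by rw [hcard]; omega) x
    rw [hcard, hexp] at h
    rwa [Nat.cast_ofNat] at h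
  have hsub : {ω | ∃ t : ℕ, (alg A).stopTime ω = t ∧
      (alg A).recommend t (firstRounds ω t) ≠ iStar} ⊆ ⋃ b ∈ Finset.univ.erase iStar, E b := by
    rintro ω ⟨t, hstopped, hrec⟩
    have hglr := ((halg A).stop_iff t _).1 ((alg A).stopsAt_of_stopTime_eq hstopped)
    obtain ⟨b, hb⟩ := exists_isUniqueBestArm_of_glrStop A hn hk hx _ hglr
    rw [(halg A).recommend_eq t _ b hglr hb] at hrec
    exact Set.mem_iUnion₂.2 ⟨b, Finset.mem_erase.2 ⟨hrec, Finset.mem_univ b⟩, t, hglr.1,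
      lt_sum_penalizedDeviation A hk _ hglr hb μ (hbest b hrec)⟩
  calc _ ≤ law (alg A).sampling A μ (⋃ b ∈ Finset.univ.erase iStar, E b) := measure_mono hsub
    _ ≤ ∑ b ∈ Finset.univ.erase iStar, law (alg A).sampling A μ (E b) :=
      measure_biUnion_finset_le _ _
    _ ≤ ∑ _b ∈ Finset.univ.erase iStar, ENNReal.ofReal (δ / (n - 1)) := Finset.sum_le_sum hE
    _ = ENNReal.ofReal δ := by
      rw [Finset.sum_const, Finset.card_erase_of_mem (Finset.mem_univ _), Finset.card_univ,
        Fintype.card_fin, nsmul_eq_mul, ← ENNReal.ofReal_natCast,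
        ← ENNReal.ofReal_mul (by positivity), Nat.cast_sub (by omega), Nat.cast_one,
        mul_div_cancel₀ _ (by positivity)]
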